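/- For nonzero integers $a,b$ let $L(a,b)=(L_n)_{n\ge 0}$ be the Lucas sequence of the first kind: $L_0=0$, $L_1=1$, $L_n=aL_{n-1}+bL_{n-2}$ for $n\ge 2$. Its characteristic polynomial is $x^2-ax-b$, with discriminant $D=a^2+4b$; $F=(F_n)=L(1,1)$ is the Fibonacci sequence. The rank of appearance $\alpha_L(p)$ of a prime $p$ in $L$ is the least $n\ge 1$ with $p\mid L_n$. A prime $p$ is a Wall–Sun–Sun prime if $p^2\mid F_{\alpha_F(p)}$. Theorem. Let $p\ge 3$ be a prime. (1) Let $L=L(a,1)$ with $a$ a nonzero integer, $D=a^2+4$, and suppose $\alpha_L(p)>2$. Let $\lambda_1,\lambda_2$ be the roots of $x^2-ax-1$ in an algebraic closure of $\mathbf Q_p$ (with the absolute value extending $|\cdot|_p$), and let $K=\mathbf Q_p(\sqrt D)$. Let $\pi$ be an element of $K$ with $|\pi|_p=p^{-1/2}$ if $K$ contains such an element (i.e. if $K/\mathbf Q_p$ is ramified), and $\pi=p$ otherwise (including the case $K=\mathbf Q_p$). Let $l$ be the order of $\lambda_2/\lambda_1$ modulo $\pi$, i.e. the least $l\ge1$ such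 that $\pi$ divides $(\lambda_2/\lambda_1)^l-1$ in the ring of integers $O_K$ of $K$. If $p^2\mid D$, or $(\lambda_2/\lambda_1)^l-1$ is not divisible by $\pi^2$ in $O_K$, then $$\overline{\left\{\frac{L_{n+\alpha_L(p)}}{L_n} : n\ge 0,\ L_n\neq 0\right\}}\ \cup\ \overline{\left\{\frac{L_{n+\alpha_L(p)-2}}{L_n} : n\ge 0,\ L_n\ne 0\right\}}=\mathbf Q_p,$$ where the closures are taken in $\mathbf Q_p$. (2) In particular, if $p$ is not a Wall–Sun–Sun prime, then $$\overline{\left\{\frac{F_{n+\alpha_F(p)}}{F_n} : n\ge 0,\ F_n\neq 0\right\}}\ \cup\ \overline{\left\{\frac{F_{n+\alpha_F(p)-2}}{F_n} : n\ge 0,\ F_n\ne 0\right\}}=\mathbf Q_p.$$ -/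

import Mathlib

/-- The Lucas sequence of the first kind `L(a,b)`: `L 0 = 0`, `L 1 = 1`,
`L (n+2) = a * L (n+1) + b * L n`. -/
def lucasSeq (a b : ℤ) : ℕ → ℤ
  | 0 => 0
  | 1 => 1
  | n + 2 => a * lucasSeq a b (n + 1) + b * lucasSeq a b n

/-- The characteristic polynomial `X ^ 2 - a X - b` of `L(a,b)`. -/
noncomputable def lucasCharpoly (a b : ℤ) : Polynomial ℤ :=
  Polynomial.X ^ 2 - Polynomial.C a * Polynomial.X - Polynomial.C b

/-- The discriminant `a ^ 2 + 4 b` of the characteristic polynomial of `L(a,b)`. -/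
def lucasDisc (a b : ℤ) : ℤ := a ^ 2 + 4 * b

/-- The Fibonacci sequence, as a sequence of integers. -/
def fibSeq (n : ℕ) : ℤ := (Nat.fib n : ℤ)

/-- The rank of appearance of `p` in `u`: the smallest positive `n` such that `p ∣ u n`.
(The value is `0` if there is no such `n`; this never happens for the sequences `L(a,1)`
and for the Fibonacci sequence.) -/
noncomputable def rankOfAppearance (u : ℕ → ℤ) (p : ℕ) : ℕ :=
  sInf {n : ℕ | 0 < n ∧ (p : ℤ) ∣ u n}

/-- `p` is a Wall-Sun-Sun prime: `p ^ 2` divides the term of the Fibonacci sequence whose index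
is the rank of appearance of `p`. -/
def IsWallSunSun (p : ℕ) : Prop :=
  p.Prime ∧ (p : ℤ) ^ 2 ∣ fibSeq (rankOfAppearance fibSeq p)

/-- The closure in `ℚ_[p]` of the set of all ratios `u (n + m) / u n` with `u n ≠ 0`. -/
def ratioClosure (p : ℕ) [Fact p.Prime] (u : ℕ → ℤ) (m : ℕ) : Set ℚ_[p] :=
  closure {x : ℚ_[p] | ∃ n : ℕ, u n ≠ 0 ∧ x = (u (n + m) : ℚ_[p]) / (u n : ℚ_[p])}

/-- The field `ℚ_p(√D)`, inside the algebraic closure of `ℚ_[p]` (whose norm extends the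
`p`-adic absolute value, `‖p‖ = 1 / p`). -/
noncomputable def quadField (p : ℕ) [Fact p.Prime] (D : ℤ) :
    IntermediateField ℚ_[p] (PadicAlgCl p) :=
  IntermediateField.adjoin ℚ_[p] {x : PadicAlgCl p | x ^ 2 = (D : PadicAlgCl p)}

/-- `K` is ramified (for `K = ℚ_p` or `K` quadratic over `ℚ_p`): it has an element of absolute
value `p ^ (-1/2)`. -/
def IsRamifiedQuad {p : ℕ} [Fact p.Prime] (K : IntermediateField ℚ_[p] (PadicAlgCl p)) : Prop :=
  ∃ x ∈ K, ‖x‖ ^ 2 = (p : ℝ)⁻¹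

/-- `π` is an admissible uniformizer of `K`: any element of `K` of absolute value `p ^ (-1/2)` in
the ramified case, and `p` otherwise. -/
def IsQuadUniformizer {p : ℕ} [Fact p.Prime] (K : IntermediateField ℚ_[p] (PadicAlgCl p))
    (π : PadicAlgCl p) : Prop :=
  π ∈ K ∧ (IsRamifiedQuad K → ‖π‖ ^ 2 = (p : ℝ)⁻¹) ∧
    (¬ IsRamifiedQuad K → π = (p : PadicAlgCl p))

/-- `y` is divisible by `x` with respect to the ring of integers `{z ∈ K | ‖z‖ ≤ 1}` of `K`. -/
def IntDvd {p : ℕ} [Fact p.Prime] (K : IntermediateField ℚ_[p] (PadicAlgCl p))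
    (x y : PadicAlgCl p) : Prop :=
  ∃ z ∈ K, ‖z‖ ≤ 1 ∧ y = x * z

/-- The order of `x` modulo `π`: the least `l > 0` such that `π` divides `x ^ l - 1` in the
ring of integers of `K`. -/
noncomputable def orderModulo {p : ℕ} [Fact p.Prime]
    (K : IntermediateField ℚ_[p] (PadicAlgCl p)) (π x : PadicAlgCl p) : ℕ :=
  sInf {l : ℕ | 0 < l ∧ IntDvd K π (x ^ l - 1)}

/-!
The subsequence `k ↦ L_{kn}` is `L_n` times the Lucas sequence with parameters `V_n` and
`-(-b) ^ n`, whose discriminant is `D * L_n ^ 2`. A Lucas sequence with `p ∣ D` satisfies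
`|L_k| = |k|` (for `p = 3` one needs `9 ∣ D`), so `|L_{kn}| = |L_n| |k|` as soon as `p ∣ L_n`. By
d'Ocagne's identity the map `k ↦ L_{kn} / L_{kn+1}` therefore multiplies `p`-adic distances by
`|L_n|`, and counting residues modulo powers of `p` shows that its values are dense in the ball of
radius `|L_n|` about `0`.

The ratios `L_{m+r} / L_m` with `m = kr` are the images of these values under `t ↦ c + L_r / t`, and
the ratios `L_{m+r-2} / L_m` with `m = kr + 1` are their images under an affine map. With `r` the
rank of appearance and `p ^ 2 ∤ L_r`, the two closures contain, respectively, the complement of the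
open unit ball about `L_{r-1}` and that ball. It remains to see that `p ^ 2 ∤ L_r`. If `p ∣ D`,
then `p ≠ 3` and `|L_r| = |r|` with `r ≤ p`. Otherwise `|(λ₂ / λ₁) ^ n - 1| = |L_n|`, so the order
of `λ₂ / λ₁` modulo `π` is `r`, and the claim is the hypothesis on `π ^ 2`.
-/

section Identities

variable (a b : ℤ)

theorem lucasSeq_add_two (n : ℕ) :
    lucasSeq a b (n + 2) = a * lucasSeq a b (n + 1) + b * lucasSeq a b n := rfl

theorem lucasSeq_add (m n : ℕ) :
    lucasSeq a b (m + n) = lucasSeq a b m * (lucasSeq a b (n + 1) - a * lucasSeq a b n) +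
      lucasSeq a b (m + 1) * lucasSeq a b n := by
  induction n using Nat.twoStepInduction with
  | zero => simp [lucasSeq]
  | one => simp [lucasSeq]
  | more n ih ih' =>
    rw [← add_assoc, lucasSeq_add_two, add_assoc m n 1, ih, ih']
    simp only [lucasSeq_add_two]
    ring

theorem lucasSeq_docagne (m n : ℕ) :
    lucasSeq a b (m + n) * lucasSeq a b (n + 1) - lucasSeq a b (m + n + 1) * lucasSeq a b n =
      (-b) ^ n * lucasSeq a b m := by
  induction n with
  | zero => simp [lucasSeq]
  | succ n ih =>
    rw [← add_assoc, lucasSeq_add_two, lucasSeq_add_two, pow_succ]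
    linear_combination -b * ih

/-- The Lucas sequence of the second kind `V_n = λ₁ ^ n + λ₂ ^ n`, where `λ₁`, `λ₂` are the roots of
`X ^ 2 - a X - b`; it is encoded as `2 L_{n+1} - a L_n`. -/
def lucasCompanion (n : ℕ) : ℤ := 2 * lucasSeq a b (n + 1) - a * lucasSeq a b n

theorem lucasDisc_lucasCompanion (n : ℕ) :
    lucasDisc (lucasCompanion a b n) (-(-b) ^ n) = lucasDisc a b * lucasSeq a b n ^ 2 := by
  have cassini := lucasSeq_docagne a b 1 n
  rw [add_comm 1 n, lucasSeq_add_two, show lucasSeq a b 1 = 1 from rfl] at cassini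
  simp only [lucasDisc, lucasCompanion]
  linear_combination 4 * cassini

theorem lucasSeq_add_add (m n : ℕ) :
    lucasSeq a b (m + n + n) =
      lucasCompanion a b n * lucasSeq a b (m + n) - (-b) ^ n * lucasSeq a b m := by
  rw [lucasSeq_add, lucasCompanion]
  linear_combination -lucasSeq_docagne a b m n

theorem lucasSeq_mul (k n : ℕ) :
    lucasSeq a b (k * n) =
      lucasSeq a b n * lucasSeq (lucasCompanion a b n) (-(-b) ^ n) k := by
  induction k using Nat.twoStepInduction with
  | zero => simp [lucasSeq]
  | one => simp [lucasSeq]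
  | more k ih ih' =>
    rw [Nat.succ_mul] at ih'
    rw [show (k + 2) * n = k * n + n + n by ring, lucasSeq_add_add, ih, ih', lucasSeq_add_two]
    ring

/-- The terms `j = 0, 1` of
`2 ^ n * L_{n+1} = ∑ j, (n + 1).choose (2 * j + 1) * a ^ (n - 2 * j) * D ^ j`, multiplied by
`a ^ 2` so that no subtraction occurs in an exponent. -/
theorem two_pow_mul_sq_mul_lucasSeq_succ_modEq (n : ℕ) :
    2 ^ n * a ^ 2 * lucasSeq a b (n + 1) ≡
      (n + 1) * a ^ (n + 2) + (n + 1).choose 3 * a ^ n * lucasDisc a b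
        [ZMOD lucasDisc a b ^ 2] := by
  rw [Int.modEq_iff_dvd]
  induction n using Nat.twoStepInduction with
  | zero => simp [lucasSeq, Nat.choose_eq_zero_of_lt]
  | one => exact ⟨0, by simp [lucasSeq]; ring⟩
  | more n ih ih' =>
    obtain ⟨u, hu⟩ := ih
    obtain ⟨v, hv⟩ := ih'
    have hb : 4 * b = lucasDisc a b - a ^ 2 := by simp [lucasDisc]
    have pascal : ((n + 2 + 1).choose 3 : ℤ) =
        2 * (n + 1 + 1).choose 3 - (n + 1).choose 3 + (n + 1) := by
      simp only [Nat.choose_succ_succ' (n + 2) 2, Nat.choose_succ_succ' (n + 1) 2,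
        Nat.choose_succ_succ' (n + 1) 1, Nat.choose_one_right]
      push_cast
      ring
    refine ⟨2 * a * v + 4 * b * u - (n + 1).choose 3 * a ^ n, ?_⟩
    rw [pascal, lucasSeq_add_two]
    push_cast at hv ⊢
    linear_combination 2 * a * hv + 4 * b * hu -
      ((n + 1) * a ^ (n + 2) + (n + 1).choose 3 * a ^ n * lucasDisc a b) * hb

end Identities

section PadicAbsoluteValue

variable {p : ℕ} [Fact p.Prime] {a b : ℤ}

theorem norm_intCast_eq_one_iff_not_dvd {z : ℤ} : ‖(z : ℚ_[p])‖ = 1 ↔ ¬(p : ℤ) ∣ z := by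
  rw [← Padic.norm_intCast_lt_one_iff, not_lt, (Padic.norm_int_le_one z).ge_iff_eq]

theorem norm_le_norm_intCast_of_not_sq_dvd {x : ℚ_[p]} {z : ℤ} (hx : ‖x‖ < 1)
    (hz : ¬(p : ℤ) ^ 2 ∣ z) : ‖x‖ ≤ ‖(z : ℚ_[p])‖ := by
  have hx' : ‖x‖ ≤ (p : ℝ) ^ (-1 : ℤ) := by
    simpa using (Padic.norm_lt_pow_iff_norm_le_pow_sub_one x 0).mp (by simpa using hx)
  rw [← Padic.norm_int_le_pow_iff_dvd, Padic.norm_le_pow_iff_norm_lt_pow_add_one, not_lt] at hz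
  exact hx'.trans (by simpa using hz)

theorem not_dvd_neg_neg_pow {q : ℤ} (hq : Prime q) (hb : ¬q ∣ b) (n : ℕ) : ¬q ∣ -(-b) ^ n :=
  fun h => hb (dvd_neg.mp (hq.dvd_of_dvd_pow (dvd_neg.mp h)))

theorem not_dvd_lucasSeq_succ {q : ℤ} (hq : Prime q) (hb : ¬q ∣ b) {n : ℕ}
    (h : q ∣ lucasSeq a b n) : ¬q ∣ lucasSeq a b (n + 1) := by
  intro h'
  have cassini := lucasSeq_docagne a b 1 n
  rw [add_comm 1 n, show lucasSeq a b 1 = 1 from rfl, mul_one] at cassini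
  have : q ∣ (-b) ^ n := cassini ▸ dvd_sub (h'.mul_left _) (h.mul_left _)
  exact hb (dvd_neg.mp (hq.dvd_of_dvd_pow this))

theorem not_dvd_of_dvd_lucasDisc {q : ℤ} (hq : Prime q) (hq2 : ¬q ∣ 2) (hb : ¬q ∣ b)
    (hD : q ∣ lucasDisc a b) : ¬q ∣ a := by
  intro ha
  have h4b : q ∣ 2 ^ 2 * b := by simpa [lucasDisc] using dvd_sub hD (dvd_pow ha two_ne_zero)
  exact (hq.dvd_or_dvd h4b).elim (fun h => hq2 (hq.dvd_of_dvd_pow h)) hb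

theorem norm_choose_three_mul_lt {q : ℕ} (hq : q.Prime) (hp2 : p ≠ 2) {D : ℤ}
    (hD : (p : ℤ) ∣ D) (hD3 : p = 3 → (p : ℤ) ^ 2 ∣ D) (u v : ℤ) :
    ‖((q.choose 3 * u * D + D ^ 2 * v : ℤ) : ℚ_[p])‖ < ‖(q : ℚ_[p])‖ := by
  by_cases hqp : q = p
  · subst hqp
    have hdvd : (q : ℤ) ^ 2 ∣ q.choose 3 * u * D + D ^ 2 * v := by
      refine dvd_add ?_ ((pow_dvd_pow_of_dvd hD 2).mul_right v)
      by_cases h3 : q = 3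
      · exact (hD3 h3).mul_left _
      · have h3q : 3 < q := by have := hq.two_le; omega
        have : (q : ℤ) ∣ q.choose 3 := by
          exact_mod_cast hq.dvd_choose_self three_ne_zero h3q
        exact pow_two (q : ℤ) ▸ mul_dvd_mul (this.mul_right u) hD
    refine ((Padic.norm_int_le_pow_iff_dvd _ 2).mpr (mod_cast hdvd)).trans_lt ?_
    rw [Padic.norm_p, ← zpow_neg_one]
    exact zpow_lt_zpow_right₀ (mod_cast hq.one_lt) (by norm_num)
  · rw [Padic.norm_natCast_eq_one_iff.mpr
      ((Nat.coprime_primes Fact.out hq).mpr (Ne.symm hqp)), Padic.norm_intCast_lt_one_iff]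
    exact dvd_add (hD.mul_left _) ((dvd_pow hD two_ne_zero).mul_right v)

theorem norm_lucasSeq_prime_of_dvd_lucasDisc (hp2 : p ≠ 2) (hb : ¬(p : ℤ) ∣ b)
    (hD : (p : ℤ) ∣ lucasDisc a b) (hD3 : p = 3 → (p : ℤ) ^ 2 ∣ lucasDisc a b)
    {q : ℕ} (hq : q.Prime) : ‖(lucasSeq a b q : ℚ_[p])‖ = ‖(q : ℚ_[p])‖ := by
  have h2 : ‖(2 : ℚ_[p])‖ = 1 := by
    exact_mod_cast Padic.norm_natCast_eq_one_iff.mpr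
      ((Nat.coprime_primes Fact.out Nat.prime_two).mpr hp2)
  have ha : ‖(a : ℚ_[p])‖ = 1 :=
    norm_intCast_eq_one_iff_not_dvd.mpr <| not_dvd_of_dvd_lucasDisc
      (Nat.prime_iff_prime_int.mp Fact.out)
      (norm_intCast_eq_one_iff_not_dvd.mp (by exact_mod_cast h2)) hb hD
  obtain ⟨m, rfl⟩ : ∃ m, q = m + 1 := ⟨q - 1, (Nat.sub_add_cancel hq.one_le).symm⟩
  obtain ⟨z, hz⟩ := (two_pow_mul_sq_mul_lucasSeq_succ_modEq a b m).symm.dvd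
  have expansion : (2 : ℚ_[p]) ^ m * a ^ 2 * lucasSeq a b (m + 1) =
      ((m + 1 : ℕ) : ℚ_[p]) * a ^ (m + 2) +
        (((m + 1).choose 3 * a ^ m * lucasDisc a b + lucasDisc a b ^ 2 * z : ℤ) : ℚ_[p]) := by
    exact_mod_cast show (2 : ℤ) ^ m * a ^ 2 * lucasSeq a b (m + 1) =
      ((m + 1 : ℕ) : ℤ) * a ^ (m + 2) +
        ((m + 1).choose 3 * a ^ m * lucasDisc a b + lucasDisc a b ^ 2 * z) by
      push_cast
      linear_combination hz
  have hmain : ‖((m + 1 : ℕ) : ℚ_[p]) * a ^ (m + 2)‖ = ‖((m + 1 : ℕ) : ℚ_[p])‖ := by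
    rw [norm_mul, norm_pow, ha, one_pow, mul_one]
  have herror := norm_choose_three_mul_lt hq hp2 hD hD3 (a ^ m) z
  calc ‖(lucasSeq a b (m + 1) : ℚ_[p])‖
      = ‖(2 : ℚ_[p]) ^ m * a ^ 2 * lucasSeq a b (m + 1)‖ := by simp [h2, ha]
    _ = ‖((m + 1 : ℕ) : ℚ_[p])‖ := by
        rw [expansion, IsUltrametricDist.norm_add_eq_max_of_norm_ne_norm (by
          rw [hmain]; exact herror.ne'), hmain, max_eq_left herror.le]

/-- Since `L_{kn}` is `L_n` times the `k`-th term of a Lucas sequence whose discriminant is again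
divisible by `D`, it is enough to treat prime indices. -/
theorem norm_lucasSeq_of_dvd_lucasDisc (hp2 : p ≠ 2) (hb : ¬(p : ℤ) ∣ b)
    (hD : (p : ℤ) ∣ lucasDisc a b) (hD3 : p = 3 → (p : ℤ) ^ 2 ∣ lucasDisc a b) (n : ℕ) :
    ‖(lucasSeq a b n : ℚ_[p])‖ = ‖(n : ℚ_[p])‖ := by
  induction n using Nat.recOnMul generalizing a b with
  | zero => simp [lucasSeq]
  | one => simp [lucasSeq]
  | prime q hq => exact norm_lucasSeq_prime_of_dvd_lucasDisc hp2 hb hD hD3 hq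
  | mul k n ihk ihn =>
    have hdisc : lucasDisc a b ∣ lucasDisc (lucasCompanion a b n) (-(-b) ^ n) :=
      lucasDisc_lucasCompanion a b n ▸ dvd_mul_right _ _
    have hb' := not_dvd_neg_neg_pow (Nat.prime_iff_prime_int.mp Fact.out) hb n
    rw [lucasSeq_mul, Int.cast_mul, norm_mul, ihn hb hD hD3,
      ihk hb' (hD.trans hdisc) fun h => (hD3 h).trans hdisc, Nat.cast_mul, norm_mul, mul_comm]

theorem norm_lucasSeq_mul (hp2 : p ≠ 2) (hb : ¬(p : ℤ) ∣ b) {n : ℕ}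
    (hn : (p : ℤ) ∣ lucasSeq a b n) (k : ℕ) :
    ‖(lucasSeq a b (k * n) : ℚ_[p])‖ = ‖(lucasSeq a b n : ℚ_[p])‖ * ‖(k : ℚ_[p])‖ := by
  have hb' := not_dvd_neg_neg_pow (Nat.prime_iff_prime_int.mp Fact.out) hb n
  have hdisc : (p : ℤ) ^ 2 ∣ lucasDisc (lucasCompanion a b n) (-(-b) ^ n) :=
    lucasDisc_lucasCompanion a b n ▸ (pow_dvd_pow_of_dvd hn 2).mul_left _
  rw [lucasSeq_mul, Int.cast_mul, norm_mul, norm_lucasSeq_of_dvd_lucasDisc hp2 hb'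
    ((dvd_pow_self _ two_ne_zero).trans hdisc) fun _ => hdisc]

end PadicAbsoluteValue

section Density

variable {p : ℕ} [Fact p.Prime] {a b : ℤ}

theorem denseRange_of_norm_sub_le {f : ℕ → ℤ_[p]}
    (hf : ∀ k l : ℕ, ‖(k - l : ℤ_[p])‖ ≤ ‖f k - f l‖) : DenseRange f := by
  rw [Metric.denseRange_iff]
  intro x ε hε
  obtain ⟨N, hN⟩ := PadicInt.exists_pow_neg_lt p hε
  have residue_eq_iff (y z : ℤ_[p]) :
      PadicInt.toZModPow N y = PadicInt.toZModPow N z ↔ ‖y - z‖ ≤ (p : ℝ) ^ (-N : ℤ) := by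
    rw [PadicInt.norm_le_pow_iff_mem_span_pow, ← PadicInt.ker_toZModPow, RingHom.sub_mem_ker_iff]
  have hinj : Function.Injective fun k : Fin (p ^ N) => PadicInt.toZModPow N (f k) := by
    intro k l hkl
    have h := (residue_eq_iff k l).mpr ((hf k l).trans ((residue_eq_iff _ _).mp hkl))
    rw [map_natCast, map_natCast, ZMod.natCast_eq_natCast_iff] at h
    exact Fin.ext (Nat.ModEq.eq_of_lt_of_lt h k.2 l.2)
  have hbij := (Fintype.bijective_iff_injective_and_card _).mpr ⟨hinj, by simp [ZMod.card]⟩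
  obtain ⟨k, hk⟩ := hbij.surjective (PadicInt.toZModPow N x)
  refine ⟨k, ?_⟩
  rw [dist_eq_norm]
  exact ((residue_eq_iff _ _).mp hk.symm).trans_lt hN

theorem norm_lucasSeq_mul_succ (hb : ¬(p : ℤ) ∣ b) {n : ℕ} (hn : (p : ℤ) ∣ lucasSeq a b n)
    (k : ℕ) : ‖(lucasSeq a b (k * n + 1) : ℚ_[p])‖ = 1 :=
  norm_intCast_eq_one_iff_not_dvd.mpr <|
    not_dvd_lucasSeq_succ (Nat.prime_iff_prime_int.mp Fact.out) hb
      (hn.trans (lucasSeq_mul a b k n ▸ dvd_mul_right _ _))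

theorem lucasSeq_mul_succ_ne_zero (hb : ¬(p : ℤ) ∣ b) {n : ℕ} (hn : (p : ℤ) ∣ lucasSeq a b n)
    (k : ℕ) : (lucasSeq a b (k * n + 1) : ℚ_[p]) ≠ 0 :=
  norm_ne_zero_iff.mp (by simp [norm_lucasSeq_mul_succ hb hn])

theorem norm_lucasSeq_div_sub (hp2 : p ≠ 2) (hb : ¬(p : ℤ) ∣ b) {n : ℕ}
    (hn : (p : ℤ) ∣ lucasSeq a b n) (k l : ℕ) :
    ‖(lucasSeq a b (k * n) / lucasSeq a b (k * n + 1) -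
      lucasSeq a b (l * n) / lucasSeq a b (l * n + 1) : ℚ_[p])‖ =
      ‖(lucasSeq a b n : ℚ_[p])‖ * ‖(k - l : ℚ_[p])‖ := by
  wlog hlk : l ≤ k generalizing k l
  · rw [norm_sub_rev, this l k (le_of_not_ge hlk), norm_sub_rev (l : ℚ_[p])]
  obtain ⟨j, rfl⟩ := Nat.exists_eq_add_of_le' hlk
  have docagne : (lucasSeq a b ((j + l) * n) * lucasSeq a b (l * n + 1) -
      lucasSeq a b ((j + l) * n + 1) * lucasSeq a b (l * n) : ℚ_[p]) =
        (-b) ^ (l * n) * lucasSeq a b (j * n) := by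
    rw [add_mul]
    exact_mod_cast lucasSeq_docagne a b (j * n) (l * n)
  rw [div_sub_div _ _ (lucasSeq_mul_succ_ne_zero hb hn _) (lucasSeq_mul_succ_ne_zero hb hn _),
    docagne]
  simp only [norm_div, norm_mul, norm_pow, norm_neg, norm_lucasSeq_mul_succ hb hn,
    norm_intCast_eq_one_iff_not_dvd.mpr hb, norm_lucasSeq_mul hp2 hb hn, one_pow, one_mul, div_one,
    Nat.cast_add, add_sub_cancel_right]

theorem mem_closure_range_lucasSeq_div (hp2 : p ≠ 2) (hb : ¬(p : ℤ) ∣ b) {n : ℕ}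
    (hn : (p : ℤ) ∣ lucasSeq a b n) (hn0 : lucasSeq a b n ≠ 0) {t : ℚ_[p]}
    (ht : ‖t‖ ≤ ‖(lucasSeq a b n : ℚ_[p])‖) :
    t ∈ closure (Set.range fun k : ℕ =>
      (lucasSeq a b (k * n) / lucasSeq a b (k * n + 1) : ℚ_[p])) := by
  set c : ℚ_[p] := (lucasSeq a b n : ℚ_[p])
  have hc : c ≠ 0 := Int.cast_ne_zero.mpr hn0
  have hdiv {x : ℚ_[p]} (hx : ‖x‖ ≤ ‖c‖) : ∃ z : ℤ_[p], c * z = x :=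
    ⟨⟨x / c, by rw [norm_div]; exact div_le_one_of_le₀ hx (norm_nonneg c)⟩, mul_div_cancel₀ x hc⟩
  have hratio (k : ℕ) : ‖(lucasSeq a b (k * n) / lucasSeq a b (k * n + 1) : ℚ_[p])‖ ≤ ‖c‖ := by
    rw [norm_div, norm_lucasSeq_mul_succ hb hn, div_one, norm_lucasSeq_mul hp2 hb hn]
    exact mul_le_of_le_one_right (norm_nonneg c) (mod_cast Padic.norm_int_le_one k)
  choose f hf using fun k => hdiv (hratio k)
  have hisometry (k l : ℕ) : ‖f k - f l‖ = ‖(k - l : ℤ_[p])‖ := by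
    have h := norm_lucasSeq_div_sub hp2 hb hn k l
    rw [← hf, ← hf, ← mul_sub, norm_mul] at h
    simpa [PadicInt.norm_def] using mul_left_cancel₀ (norm_ne_zero_iff.mpr hc) h
  obtain ⟨z, rfl⟩ := hdiv ht
  refine map_mem_closure (f := fun z : ℤ_[p] => c * z) (by fun_prop)
    (denseRange_of_norm_sub_le (fun k l => (hisometry k l).ge) z) ?_
  rintro _ ⟨k, rfl⟩
  exact ⟨k, (hf k).symm⟩

theorem mem_ratioClosure_of_one_le_norm_sub (hp2 : p ≠ 2) (hb : ¬(p : ℤ) ∣ b) {n : ℕ}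
    (hn : (p : ℤ) ∣ lucasSeq a b n) (hn0 : lucasSeq a b n ≠ 0) {y : ℚ_[p]}
    (hy : 1 ≤ ‖y - (lucasSeq a b (n + 1) - a * lucasSeq a b n)‖) :
    y ∈ ratioClosure p (lucasSeq a b) n := by
  set c : ℚ_[p] := lucasSeq a b (n + 1) - a * lucasSeq a b n
  set d : ℚ_[p] := (lucasSeq a b n : ℚ_[p])
  have hyc : y - c ≠ 0 := norm_pos_iff.mp (one_pos.trans_le hy)
  have hd0 : d ≠ 0 := Int.cast_ne_zero.mpr hn0
  have ht0 : d / (y - c) ≠ 0 := div_ne_zero hd0 hyc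
  have ht : d / (y - c) ∈ closure ({0}ᶜ ∩ Set.range fun k : ℕ =>
      (lucasSeq a b (k * n) / lucasSeq a b (k * n + 1) : ℚ_[p])) :=
    isOpen_compl_singleton.inter_closure ⟨ht0, mem_closure_range_lucasSeq_div hp2 hb hn hn0
      (by rw [norm_div]; exact div_le_self (norm_nonneg d) hy)⟩
  have hcont : ContinuousAt (fun t => c + d / t) (d / (y - c)) := by fun_prop (disch := exact ht0)
  have hy' : c + d / (d / (y - c)) = y := by rw [div_div_cancel₀ hd0, add_sub_cancel]
  refine hy' ▸ hcont.continuousWithinAt.mem_closure ht ?_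
  rintro _ ⟨hk, k, rfl⟩
  have hX : (lucasSeq a b (k * n) : ℚ_[p]) ≠ 0 := fun h => hk (by simp [h])
  refine ⟨k * n, Int.cast_ne_zero.mp hX, ?_⟩
  rw [lucasSeq_add]
  push_cast
  field_simp
  simp only [c, d]
  ring

theorem mem_ratioClosure_of_norm_sub_le (hp2 : p ≠ 2) (hb : ¬(p : ℤ) ∣ b) {n j : ℕ}
    (hn : (p : ℤ) ∣ lucasSeq a b n) (hn0 : lucasSeq a b n ≠ 0) (hj0 : lucasSeq a b j ≠ 0)
    {y : ℚ_[p]} (hy : ‖y - lucasSeq a b (j + 1)‖ ≤ ‖(lucasSeq a b j * lucasSeq a b n : ℚ_[p])‖) :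
    y ∈ ratioClosure p (lucasSeq a b) j := by
  set c : ℚ_[p] := (lucasSeq a b (j + 1) : ℚ_[p])
  have hbj : (b * lucasSeq a b j : ℚ_[p]) ≠ 0 := by
    refine mul_ne_zero (Int.cast_ne_zero.mpr fun h => hb (h ▸ dvd_zero _)) (mod_cast hj0)
  have ht := mem_closure_range_lucasSeq_div hp2 hb hn hn0
    (t := (y - c) / (b * lucasSeq a b j)) (by
      rw [norm_mul] at hy
      rw [norm_div, norm_mul, norm_intCast_eq_one_iff_not_dvd.mpr hb, one_mul]
      exact div_le_of_le_mul₀ (norm_nonneg _) (norm_nonneg _) (by rwa [mul_comm]))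
  have hy' : c + b * lucasSeq a b j * ((y - c) / (b * lucasSeq a b j)) = y := by
    rw [mul_div_cancel₀ _ hbj, add_sub_cancel]
  refine hy' ▸ map_mem_closure (f := fun t => c + b * lucasSeq a b j * t) (by fun_prop) ht ?_
  rintro _ ⟨k, rfl⟩
  have hY := lucasSeq_mul_succ_ne_zero hb hn k
  refine ⟨k * n + 1, Int.cast_ne_zero.mp hY, ?_⟩
  rw [lucasSeq_add, lucasSeq_add_two]
  push_cast
  field_simp
  simp only [c]
  ring

theorem not_dvd_of_modEq_one {q : ℤ} (hq : Prime q) (hb : b ≡ 1 [ZMOD q]) : ¬q ∣ b :=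
  fun h => hq.not_dvd_one ((dvd_sub_left h).mp hb.dvd)

theorem ratioClosure_union_eq_univ (hp2 : p ≠ 2) (hb : b ≡ 1 [ZMOD p]) {j : ℕ}
    (hj : ¬(p : ℤ) ∣ lucasSeq a b j) (hn : (p : ℤ) ∣ lucasSeq a b (j + 2))
    (hsq : ¬(p : ℤ) ^ 2 ∣ lucasSeq a b (j + 2)) :
    ratioClosure p (lucasSeq a b) (j + 2) ∪ ratioClosure p (lucasSeq a b) j = Set.univ := by
  have hbp := not_dvd_of_modEq_one (Nat.prime_iff_prime_int.mp Fact.out) hb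
  have hn0 : lucasSeq a b (j + 2) ≠ 0 := fun h => hsq (h ▸ dvd_zero _)
  rw [Set.eq_univ_iff_forall]
  intro y
  rcases lt_or_ge ‖y - lucasSeq a b (j + 1)‖ 1 with hy | hy
  · right
    refine mem_ratioClosure_of_norm_sub_le hp2 hbp hn hn0 (fun h => hj (h ▸ dvd_zero _)) ?_
    rw [norm_mul, norm_intCast_eq_one_iff_not_dvd.mpr hj, one_mul]
    exact norm_le_norm_intCast_of_not_sq_dvd hy hsq
  · left
    refine mem_ratioClosure_of_one_le_norm_sub hp2 hbp hn hn0 (not_lt.mp fun hlt => hy.not_gt ?_)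
    have hcongr : ‖((b - 1) * lucasSeq a b (j + 1) : ℚ_[p])‖ < 1 := by
      exact_mod_cast Padic.norm_intCast_lt_one_iff.mpr (hb.symm.dvd.mul_right _)
    have hsplit : y - lucasSeq a b (j + 1) =
        (y - (lucasSeq a b (j + 2 + 1) - a * lucasSeq a b (j + 2))) +
          (b - 1) * lucasSeq a b (j + 1) := by
      rw [lucasSeq_add_two a b (j + 1)]
      push_cast
      ring
    rw [hsplit]
    exact (IsUltrametricDist.norm_add_le_max _ _).trans_lt (max_lt hlt hcongr)

end Density

section CharacteristicRoots

variable {K : Type*} {a b : ℤ} {x y : K}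

theorem add_eq_and_mul_eq_of_aroots_lucasCharpoly [CommRing K] [IsDomain K]
    (h : (lucasCharpoly a b).aroots K = {x, y}) : x + y = a ∧ x * y = -b := by
  have hquad : lucasCharpoly a b = Polynomial.C 1 * Polynomial.X ^ 2 +
      Polynomial.C (-a) * Polynomial.X + Polynomial.C (-b) := by
    simp only [lucasCharpoly, map_one, map_neg]
    ring
  rw [hquad] at h
  have hsum := Polynomial.eq_neg_mul_add_of_aroots_quadratic_eq_pair h
  have hprod := Polynomial.eq_mul_mul_of_aroots_quadratic_eq_pair h
  simp only [eq_intCast, Int.cast_neg, Int.cast_one] at hsum hprod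
  exact ⟨by linear_combination hsum, by linear_combination -hprod⟩

theorem sq_sub_eq_lucasDisc [CommRing K] (hs : x + y = a) (hm : x * y = -b) :
    (x - y) ^ 2 = (lucasDisc a b : K) := by
  simp only [lucasDisc]
  push_cast
  rw [← hs]
  linear_combination -4 * hm

theorem lucasSeq_mul_sub [CommRing K] (hs : x + y = a) (hm : x * y = -b) (n : ℕ) :
    lucasSeq a b n * (x - y) = x ^ n - y ^ n := by
  induction n using Nat.twoStepInduction with
  | zero => simp [lucasSeq]
  | one => simp [lucasSeq]
  | more n ih ih' =>
    rw [lucasSeq_add_two]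
    push_cast
    linear_combination (x + y) * ih' - x * y * ih - lucasSeq a b (n + 1) * (x - y) * hs +
      lucasSeq a b n * (x - y) * hm

theorem norm_div_pow_sub_one [NormedField K] (hs : x + y = a) (hm : x * y = -b) (hx : ‖x‖ = 1)
    (n : ℕ) : ‖(y / x) ^ n - 1‖ = ‖(lucasSeq a b n : K)‖ * ‖x - y‖ := by
  have hx0 : x ^ n ≠ 0 := pow_ne_zero n (norm_ne_zero_iff.mp (by simp [hx]))
  rw [div_pow, div_sub_one hx0, norm_div, norm_pow, hx, one_pow, div_one, norm_sub_rev,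
    ← lucasSeq_mul_sub hs hm, norm_mul]

theorem norm_eq_one_of_norm_add_le_of_norm_mul_eq [NormedField K] [IsUltrametricDist K]
    (hs : ‖x + y‖ ≤ 1) (hm : ‖x * y‖ = 1) : ‖x‖ = 1 := by
  rw [norm_mul] at hm
  by_cases hxy : ‖x‖ = ‖y‖
  · rwa [← hxy, ← pow_two, pow_eq_one_iff_of_nonneg (norm_nonneg x) two_ne_zero] at hm
  · rw [IsUltrametricDist.norm_add_eq_max_of_norm_ne_norm hxy, max_le_iff] at hs
    refine le_antisymm hs.1 ?_
    exact hm ▸ mul_le_of_le_one_right (norm_nonneg x) hs.2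

end CharacteristicRoots

section RankOfAppearance

variable {u : ℕ → ℤ} {p : ℕ}

theorem dvd_rankOfAppearance (h : rankOfAppearance u p ≠ 0) :
    (p : ℤ) ∣ u (rankOfAppearance u p) :=
  (Nat.sInf_mem (Nat.nonempty_of_pos_sInf (Nat.pos_of_ne_zero h))).2

theorem rankOfAppearance_le {n : ℕ} (hn : 0 < n) (h : (p : ℤ) ∣ u n) :
    rankOfAppearance u p ≤ n :=
  Nat.sInf_le ⟨hn, h⟩

theorem not_dvd_of_lt_rankOfAppearance {n : ℕ} (hn : 0 < n) (h : n < rankOfAppearance u p) :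
    ¬(p : ℤ) ∣ u n :=
  fun hdvd => h.not_ge (rankOfAppearance_le hn hdvd)

end RankOfAppearance

section QuadraticField

variable {p : ℕ} [Fact p.Prime] {K : IntermediateField ℚ_[p] (PadicAlgCl p)}
  {x y π : PadicAlgCl p} {a b : ℤ}

theorem norm_intCast_padicAlgCl (z : ℤ) : ‖(z : PadicAlgCl p)‖ = ‖(z : ℚ_[p])‖ := by
  rw [← PadicAlgCl.norm_extends, map_intCast]

theorem norm_prime_padicAlgCl : ‖(p : PadicAlgCl p)‖ = (p : ℝ)⁻¹ := by
  simpa using norm_intCast_padicAlgCl (p := p) p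

theorem intDvd_iff_norm_le (hx : x ∈ K) (hy : y ∈ K) (hx0 : x ≠ 0) :
    IntDvd K x y ↔ ‖y‖ ≤ ‖x‖ := by
  constructor
  · rintro ⟨z, -, hz, rfl⟩
    exact norm_mul x z ▸ mul_le_of_le_one_right (norm_nonneg x) hz
  · intro h
    refine ⟨y / x, div_mem hy hx, ?_, (mul_div_cancel₀ y hx0).symm⟩
    exact norm_div y x ▸ div_le_one_of_le₀ h (norm_nonneg x)

theorem IsQuadUniformizer.norm_lt_one (hπ : IsQuadUniformizer K π) : ‖π‖ < 1 := by
  have hp : (p : ℝ)⁻¹ < 1 := inv_lt_one_of_one_lt₀ (mod_cast (Fact.out : p.Prime).one_lt)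
  by_cases hK : IsRamifiedQuad K
  · rwa [← pow_lt_one_iff_of_nonneg (norm_nonneg π) two_ne_zero, hπ.2.1 hK]
  · rwa [hπ.2.2 hK, norm_prime_padicAlgCl]

theorem IsQuadUniformizer.inv_le_norm (hπ : IsQuadUniformizer K π) : (p : ℝ)⁻¹ ≤ ‖π‖ := by
  by_cases hK : IsRamifiedQuad K
  · rw [← hπ.2.1 hK]
    exact pow_le_of_le_one (norm_nonneg π) hπ.norm_lt_one.le two_ne_zero
  · rw [hπ.2.2 hK, norm_prime_padicAlgCl]

theorem IsQuadUniformizer.ne_zero (hπ : IsQuadUniformizer K π) : π ≠ 0 :=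
  norm_pos_iff.mp ((inv_pos.mpr (mod_cast (Fact.out : p.Prime).pos)).trans_le hπ.inv_le_norm)

theorem div_mem_quadField (hs : x + y = a) (hm : x * y = -b) :
    y / x ∈ quadField p (lucasDisc a b) := by
  have hsub : x - y ∈ quadField p (lucasDisc a b) :=
    IntermediateField.subset_adjoin _ _ (sq_sub_eq_lucasDisc hs hm)
  have hx : x ∈ quadField p (lucasDisc a b) := by
    rw [show x = (a + (x - y)) / 2 by rw [← hs]; ring]
    exact div_mem (add_mem (intCast_mem _ a) hsub) (ofNat_mem _ 2)
  exact div_mem (by simpa using sub_mem hx hsub) hx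

theorem norm_div_pow_sub_one_of_not_dvd_lucasDisc (hb : ¬(p : ℤ) ∣ b)
    (hD : ¬(p : ℤ) ∣ lucasDisc a b) (hs : x + y = a) (hm : x * y = -b) (n : ℕ) :
    ‖(y / x) ^ n - 1‖ = ‖(lucasSeq a b n : ℚ_[p])‖ := by
  have hx : ‖x‖ = 1 := by
    apply norm_eq_one_of_norm_add_le_of_norm_mul_eq (y := y)
    · rw [hs, norm_intCast_padicAlgCl]
      exact Padic.norm_int_le_one a
    · rw [hm, norm_neg, norm_intCast_padicAlgCl, norm_intCast_eq_one_iff_not_dvd.mpr hb]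
  have hxy : ‖x - y‖ = 1 := by
    rw [← pow_eq_one_iff_of_nonneg (norm_nonneg _) two_ne_zero, ← norm_pow,
      sq_sub_eq_lucasDisc hs hm, norm_intCast_padicAlgCl, norm_intCast_eq_one_iff_not_dvd.mpr hD]
  rw [norm_div_pow_sub_one hs hm hx, hxy, mul_one, norm_intCast_padicAlgCl]

theorem intDvd_div_pow_sub_one_iff (hb : ¬(p : ℤ) ∣ b) (hD : ¬(p : ℤ) ∣ lucasDisc a b)
    (hs : x + y = a) (hm : x * y = -b) (hπ : π ∈ quadField p (lucasDisc a b)) (hπ0 : π ≠ 0)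
    (n : ℕ) :
    IntDvd (quadField p (lucasDisc a b)) π ((y / x) ^ n - 1) ↔
      ‖(lucasSeq a b n : ℚ_[p])‖ ≤ ‖π‖ := by
  rw [intDvd_iff_norm_le hπ (sub_mem (pow_mem (div_mem_quadField hs hm) n) (one_mem _)) hπ0,
    norm_div_pow_sub_one_of_not_dvd_lucasDisc hb hD hs hm]

theorem orderModulo_eq_rankOfAppearance (hb : ¬(p : ℤ) ∣ b) (hD : ¬(p : ℤ) ∣ lucasDisc a b)
    (hs : x + y = a) (hm : x * y = -b) (hπ : IsQuadUniformizer (quadField p (lucasDisc a b)) π) :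
    orderModulo (quadField p (lucasDisc a b)) π (y / x) =
      rankOfAppearance (lucasSeq a b) p := by
  simp only [orderModulo, rankOfAppearance, intDvd_div_pow_sub_one_iff hb hD hs hm hπ.1 hπ.ne_zero]
  congr! 4 with n
  constructor
  · intro h
    exact Padic.norm_intCast_lt_one_iff.mp (h.trans_lt hπ.norm_lt_one)
  · intro h
    have := (Padic.norm_int_le_pow_iff_dvd (lucasSeq a b n) 1).mpr (by simpa using h)
    exact (by simpa using this : _ ≤ (p : ℝ)⁻¹).trans hπ.inv_le_norm

theorem not_sq_dvd_lucasSeq_rankOfAppearance_of_not_intDvd (hb : ¬(p : ℤ) ∣ b)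
    (hD : ¬(p : ℤ) ∣ lucasDisc a b) (hs : x + y = a) (hm : x * y = -b)
    (hπ : IsQuadUniformizer (quadField p (lucasDisc a b)) π)
    (h : ¬IntDvd (quadField p (lucasDisc a b)) (π ^ 2)
      ((y / x) ^ orderModulo (quadField p (lucasDisc a b)) π (y / x) - 1)) :
    ¬(p : ℤ) ^ 2 ∣ lucasSeq a b (rankOfAppearance (lucasSeq a b) p) := by
  rw [orderModulo_eq_rankOfAppearance hb hD hs hm hπ,
    intDvd_div_pow_sub_one_iff hb hD hs hm (pow_mem hπ.1 2) (pow_ne_zero 2 hπ.ne_zero)] at h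
  refine fun hsq => h (((Padic.norm_int_le_pow_iff_dvd _ 2).mpr (mod_cast hsq)).trans ?_)
  rw [norm_pow, zpow_neg, ← inv_zpow]
  exact pow_le_pow_left₀ (by positivity) hπ.inv_le_norm 2

end QuadraticField

section MainTheorem

variable {p : ℕ} [Fact p.Prime] {a b : ℤ}

theorem not_dvd_lucasDisc_three (hb : b ≡ 1 [ZMOD 3]) : ¬(3 : ℤ) ∣ lucasDisc a b := by
  intro hD
  have hsq : a ^ 2 % 3 = 0 ∨ a ^ 2 % 3 = 1 := by
    rcases (by omega : a % 3 = 0 ∨ a % 3 = 1 ∨ a % 3 = 2) with h | h | h <;>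
      simp [pow_two, Int.mul_emod, h]
  simp only [lucasDisc, Int.ModEq] at hb hD
  omega

theorem not_sq_dvd_lucasSeq_rankOfAppearance_of_dvd_lucasDisc (hp2 : p ≠ 2)
    (hb : b ≡ 1 [ZMOD p]) (hD : (p : ℤ) ∣ lucasDisc a b)
    (hr : rankOfAppearance (lucasSeq a b) p ≠ 0) :
    ¬(p : ℤ) ^ 2 ∣ lucasSeq a b (rankOfAppearance (lucasSeq a b) p) := by
  have hp : p.Prime := Fact.out
  have hp3 : p ≠ 3 := by
    rintro rfl
    exact not_dvd_lucasDisc_three hb hD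
  have hnorm := norm_lucasSeq_of_dvd_lucasDisc hp2
    (not_dvd_of_modEq_one (Nat.prime_iff_prime_int.mp hp) hb) hD fun h => absurd h hp3
  have hle : rankOfAppearance (lucasSeq a b) p ≤ p := by
    refine rankOfAppearance_le hp.pos (Padic.norm_intCast_lt_one_iff.mp ?_)
    exact hnorm p ▸ Padic.norm_p_lt_one
  intro hsq
  rw [← Padic.norm_int_le_pow_iff_dvd, hnorm, ← Int.cast_natCast,
    Padic.norm_int_le_pow_iff_dvd] at hsq
  have : p ^ 2 ≤ p := (Nat.le_of_dvd (Nat.pos_of_ne_zero hr) (mod_cast hsq)).trans hle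
  exact this.not_gt (lt_self_pow₀ hp.one_lt one_lt_two)

theorem ratioClosure_rankOfAppearance_union_eq_univ (hp2 : p ≠ 2) (hb : b ≡ 1 [ZMOD p])
    (hr : 2 < rankOfAppearance (lucasSeq a b) p)
    (hsq : ¬(p : ℤ) ^ 2 ∣ lucasSeq a b (rankOfAppearance (lucasSeq a b) p)) :
    ratioClosure p (lucasSeq a b) (rankOfAppearance (lucasSeq a b) p) ∪
      ratioClosure p (lucasSeq a b) (rankOfAppearance (lucasSeq a b) p - 2) = Set.univ := by
  have hdvd := dvd_rankOfAppearance (Nat.ne_zero_of_lt hr)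
  have hj := not_dvd_of_lt_rankOfAppearance (u := lucasSeq a b) (p := p)
    (Nat.sub_pos_of_lt hr) (by omega)
  generalize rankOfAppearance (lucasSeq a b) p = r at *
  obtain ⟨j, rfl⟩ := Nat.exists_eq_add_of_le' hr.le
  exact ratioClosure_union_eq_univ hp2 hb hj hdvd hsq

theorem fibSeq_eq_lucasSeq : fibSeq = lucasSeq 1 1 := by
  funext n
  induction n using Nat.twoStepInduction with
  | zero => rfl
  | one => rfl
  | more n ih ih' =>
    rw [lucasSeq_add_two, ← ih, ← ih', fibSeq, Nat.fib_add_two, fibSeq, fibSeq]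
    push_cast
    ring

theorem two_lt_rankOfAppearance_fibSeq (h : rankOfAppearance fibSeq p ≠ 0) :
    2 < rankOfAppearance fibSeq p := by
  have hdvd := dvd_rankOfAppearance h
  have hp1 : ¬(p : ℤ) ∣ 1 := (Nat.prime_iff_prime_int.mp Fact.out).not_dvd_one
  by_contra! hle
  interval_cases rankOfAppearance fibSeq p
  · exact h rfl
  · exact hp1 hdvd
  · exact hp1 hdvd

theorem mainTheorem4_general (hp2 : p ≠ 2) :
    (∀ a b : ℤ, b ≡ 1 [ZMOD p] → 2 < rankOfAppearance (lucasSeq a b) p →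
      ∀ lam₁ lam₂ π : PadicAlgCl p,
        (lucasCharpoly a b).aroots (PadicAlgCl p) = {lam₁, lam₂} →
        IsQuadUniformizer (quadField p (lucasDisc a b)) π →
        ((p : ℤ) ∣ lucasDisc a b ∨
          ¬ IntDvd (quadField p (lucasDisc a b)) (π ^ 2)
            ((lam₂ / lam₁) ^
              orderModulo (quadField p (lucasDisc a b)) π (lam₂ / lam₁) - 1)) →
        ratioClosure p (lucasSeq a b) (rankOfAppearance (lucasSeq a b) p) ∪
          ratioClosure p (lucasSeq a b) (rankOfAppearance (lucasSeq a b) p - 2) = Set.univ) ∧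
    (¬ IsWallSunSun p →
      ratioClosure p fibSeq (rankOfAppearance fibSeq p) ∪
        ratioClosure p fibSeq (rankOfAppearance fibSeq p - 2) = Set.univ) := by
  refine ⟨fun a b hb hr x y π hroots hπ h => ?_, fun hW => ?_⟩
  · refine ratioClosure_rankOfAppearance_union_eq_univ hp2 hb hr ?_
    by_cases hD : (p : ℤ) ∣ lucasDisc a b
    · exact not_sq_dvd_lucasSeq_rankOfAppearance_of_dvd_lucasDisc hp2 hb hD (Nat.ne_zero_of_lt hr)
    · obtain ⟨hs, hm⟩ := add_eq_and_mul_eq_of_aroots_lucasCharpoly hroots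
      exact not_sq_dvd_lucasSeq_rankOfAppearance_of_not_intDvd
        (not_dvd_of_modEq_one (Nat.prime_iff_prime_int.mp Fact.out) hb) hD hs hm hπ
        (h.resolve_left hD)
  · have hsq : ¬(p : ℤ) ^ 2 ∣ fibSeq (rankOfAppearance fibSeq p) := fun h => hW ⟨Fact.out, h⟩
    have hr := two_lt_rankOfAppearance_fibSeq (p := p) fun h => hsq (by simp [h, fibSeq])
    rw [fibSeq_eq_lucasSeq] at *
    exact ratioClosure_rankOfAppearance_union_eq_univ hp2 rfl hr hsq

end MainTheorem

theorem mainTheorem4 (p : ℕ) [Fact p.Prime] (hp : 3 ≤ p) :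
    (∀ a : ℤ, a ≠ 0 → 2 < rankOfAppearance (lucasSeq a 1) p →
      ∀ lam₁ lam₂ π : PadicAlgCl p,
        (lucasCharpoly a 1).aroots (PadicAlgCl p) = {lam₁, lam₂} →
        IsQuadUniformizer (quadField p (lucasDisc a 1)) π →
        ((p : ℤ) ^ 2 ∣ lucasDisc a 1 ∨
          ¬ IntDvd (quadField p (lucasDisc a 1)) (π ^ 2)
            ((lam₂ / lam₁) ^
              orderModulo (quadField p (lucasDisc a 1)) π (lam₂ / lam₁) - 1)) →
        ratioClosure p (lucasSeq a 1) (rankOfAppearance (lucasSeq a 1) p) ∪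
          ratioClosure p (lucasSeq a 1) (rankOfAppearance (lucasSeq a 1) p - 2) =
            (Set.univ : Set ℚ_[p])) ∧
    (¬ IsWallSunSun p →
      ratioClosure p fibSeq (rankOfAppearance fibSeq p) ∪
        ratioClosure p fibSeq (rankOfAppearance fibSeq p - 2) =
          (Set.univ : Set ℚ_[p])) :=
  ⟨fun a _ hr x y π hroots hπ h => (mainTheorem4_general (by omega)).1 a 1 rfl hr x y π hroots hπ
    (h.imp_left (dvd_trans (dvd_pow_self _ two_ne_zero))), (mainTheorem4_general (by omega)).2⟩
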